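/- Let $n\ge 1$ be an integer and let $\zeta$ be a real number that is not algebraic of degree $\le n$ (over $\mathbb{Q}$). All suprema below are taken in $[-\infty,\infty]$. For a complex algebraic number $\alpha$ let $H(\alpha)$ denote the largest absolute value of the coefficients of its minimal polynomial with relatively prime integer coefficients. Let $w_n^*(\zeta)$ be the supremum of all $\nu\in\mathbb{R}$ such that $|\zeta-\alpha|\le H(\alpha)^{-\nu-1}$ holds for infinitely many complex algebraic numbers $\alpha$ of degree $\le n$. Let $\widehat w_n^*(\zeta)$ be the supremum of all $\nu\in\mathbb{R}$ such that for all sufficiently large real $X$ there is a complex algebraic number $\alpha$ of degree $\le n$ with $$H(\alpha)\le X,\qquad |\zeta-\alpha|\le H(\alpha)^{-1}X^{-\nu}.$$ For $1\le j\le n+1$ let $w_{n,j}(\zeta)$ (respectively $\widehat w_{n,j}(\zeta)$) be the supremum of all $\nu\in\mathbb{R}$ such that the system $$|y_i|\le X\quad(1\le i\le n),\qquad |x+\zeta y_1+\cdots+\zeta^n y_n|\le X^{-\nu}$$ has $j$ linearly independent solutions $(x,y_1,\ldots,y_n)\in\mathbb{Z}^{n+1}$ for arbitrarily large real $X$ (respectively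 for all sufficiently large real $X$). Then $$w_n^*(\zeta)\ \ge\ w_{n,n+1}(\zeta)\qquad\text{and}\qquad \widehat w_n^*(\zeta)\ \ge\ \widehat w_{n,n+1}(\zeta).$$ Moreover, the second inequality also holds if, in the definition of $\widehat w_n^*(\zeta)$, the condition $|\zeta-\alpha|\le H(\alpha)^{-1}X^{-\nu}$ is replaced by the more restrictive condition $|\zeta-\alpha|\le X^{-\nu-1}$. -/

import Mathlib

open Polynomial Filter

namespace DiophApprox

/-- The height `H(P)` of an integer polynomial: the largest absolute value of its coefficients. -/
def polyHeight (P : ℤ[X]) : ℕ :=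
  P.support.sup fun i => (P.coeff i).natAbs

/-- The minimal polynomial of `α` over `ℤ`: the minimal polynomial over `ℚ`, with denominators
cleared and divided by the content, so that its coefficients are relatively prime integers.
(It is determined by `α` up to sign.) -/
noncomputable def intMinpoly (α : ℂ) : ℤ[X] :=
  (IsLocalization.integerNormalization (nonZeroDivisors ℤ) (minpoly ℚ α)).primPart

/-- The height `H(α)` of a complex algebraic number. -/
noncomputable def algHeight (α : ℂ) : ℕ :=
  polyHeight (intMinpoly α)

/-- The complex number `α` is algebraic (over `ℚ`) of degree at most `n`. -/
def AlgDegLE (n : ℕ) (α : ℂ) : Prop :=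
  IsAlgebraic ℚ α ∧ (minpoly ℚ α).natDegree ≤ n

/-- The integer point `v = (x, y₁, …, yₙ)` satisfies
`|yᵢ| ≤ X` for `1 ≤ i ≤ n` and `|x + ζ y₁ + ⋯ + ζⁿ yₙ| ≤ X ^ (-ν)`. -/
def IsLinFormSol (n : ℕ) (ζ ν X : ℝ) (v : Fin (n + 1) → ℤ) : Prop :=
  (∀ i : Fin n, |(v i.succ : ℝ)| ≤ X) ∧
    |∑ i : Fin (n + 1), ζ ^ (i : ℕ) * (v i : ℝ)| ≤ X ^ (-ν)

/-- The system with parameters `ν`, `X` has `j` linearly independent integer solutions. -/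
def HasIndepSols (n j : ℕ) (ζ ν X : ℝ) : Prop :=
  ∃ v : Fin j → Fin (n + 1) → ℤ, LinearIndependent ℤ v ∧ ∀ k, IsLinFormSol n ζ ν X (v k)

/-- The ordinary linear form constant `w_{n,j}(ζ)`, a supremum in `[-∞, ∞]`:
`j` independent solutions for arbitrarily large `X`. -/
noncomputable def w (n j : ℕ) (ζ : ℝ) : EReal :=
  sSup ((fun ν : ℝ => (ν : EReal)) '' {ν : ℝ | ∃ᶠ X : ℝ in atTop, HasIndepSols n j ζ ν X})

/-- The uniform linear form constant `ŵ_{n,j}(ζ)`: `j` independent solutions for all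
sufficiently large `X`. -/
noncomputable def wHat (n j : ℕ) (ζ : ℝ) : EReal :=
  sSup ((fun ν : ℝ => (ν : EReal)) '' {ν : ℝ | ∀ᶠ X : ℝ in atTop, HasIndepSols n j ζ ν X})

/-- `w_n^*(ζ)`: the supremum of all real `ν` such that `|ζ - α| ≤ H(α) ^ (-ν - 1)` for infinitely
many algebraic `α` of degree at most `n`. -/
noncomputable def wStar (n : ℕ) (ζ : ℝ) : EReal :=
  sSup ((fun ν : ℝ => (ν : EReal)) ''
    {ν : ℝ | {α : ℂ | AlgDegLE n α ∧ ‖(ζ : ℂ) - α‖ ≤ (algHeight α : ℝ) ^ (-ν - 1)}.Infinite})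

/-- `ŵ_n^*(ζ)`: the supremum of all real `ν` such that for all sufficiently large `X` there is an
algebraic `α` of degree at most `n` with `H(α) ≤ X` and `|ζ - α| ≤ H(α)⁻¹ X ^ (-ν)`. -/
noncomputable def wStarHat (n : ℕ) (ζ : ℝ) : EReal :=
  sSup ((fun ν : ℝ => (ν : EReal)) ''
    {ν : ℝ | ∀ᶠ X : ℝ in atTop, ∃ α : ℂ, AlgDegLE n α ∧ (algHeight α : ℝ) ≤ X ∧
      ‖(ζ : ℂ) - α‖ ≤ (algHeight α : ℝ)⁻¹ * X ^ (-ν)})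

/-- The variant of `ŵ_n^*(ζ)` with the more restrictive inequality `|ζ - α| ≤ X ^ (-ν - 1)`. -/
noncomputable def wStarHatStrict (n : ℕ) (ζ : ℝ) : EReal :=
  sSup ((fun ν : ℝ => (ν : EReal)) ''
    {ν : ℝ | ∀ᶠ X : ℝ in atTop, ∃ α : ℂ, AlgDegLE n α ∧ (algHeight α : ℝ) ≤ X ∧
      ‖(ζ : ℂ) - α‖ ≤ X ^ (-ν - 1)})

end DiophApprox

namespace DiophApprox

/-! The n + 1 independent solutions at X span a full-rank lattice of integer polynomials of height ≪
X and value ≪ X^(-ν) at ζ. Perturb the real polynomial A X (T - ζ), which vanishes at ζ and has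
slope A X there, by a bounded real combination of these solutions. The result can be made an integer
polynomial Q in a prescribed class mod 4 (`exists_congruent_near`), chosen so that Q is Eisenstein
at 2 of degree n. Then H(Q) ≪ X, |Q(ζ)| ≪ X^(-ν) and |Q'(ζ)| ≥ X, so some root α satisfies |ζ - α| ≪
X^(-ν-1) (`exists_root_norm_sub_mul_le`), while irreducibility up to content gives H(α) ≤ H(Q). The
implied constants vanish in the suprema. -/

theorem isEisensteinAt_of_C_mul {R : Type*} [CommRing R] [IsDomain R] {I : Ideal R}
    (hI : I.IsPrime) {c : R} {f : R[X]} (h : (C c * f).IsEisensteinAt I) :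
    f.IsEisensteinAt I := by
  have hl : c * f.leadingCoeff ∉ I := by simpa [leadingCoeff_mul] using h.leading
  have hc : c ∉ I := fun hc => hl (I.mul_mem_right _ hc)
  have hc0 : c ≠ 0 := fun h0 => hc (h0 ▸ I.zero_mem)
  refine ⟨fun hf => hl (I.mul_mem_left _ hf), fun {m} hm => ?_, fun hf => h.notMem ?_⟩
  · have := h.mem (n := m) (by rwa [natDegree_C_mul hc0])
    rw [coeff_C_mul] at this
    exact (hI.mem_or_mem this).resolve_left hc
  · rw [coeff_C_mul]
    exact Ideal.mul_mem_left _ _ hf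

/-! ### Heights and integral minimal polynomials -/

theorem natAbs_coeff_le_polyHeight (P : ℤ[X]) (i : ℕ) : (P.coeff i).natAbs ≤ polyHeight P := by
  by_cases hi : i ∈ P.support
  · exact Finset.le_sup (f := fun i => (P.coeff i).natAbs) hi
  · simp [notMem_support_iff.1 hi]

theorem polyHeight_le_iff {P : ℤ[X]} {B : ℕ} :
    polyHeight P ≤ B ↔ ∀ i, (P.coeff i).natAbs ≤ B :=
  ⟨fun h i => (natAbs_coeff_le_polyHeight P i).trans h, fun h => Finset.sup_le fun i _ => h i⟩

theorem polyHeight_le_of_dvd_of_natDegree_eq {P Q : ℤ[X]} (hQ : Q ≠ 0) (h : P ∣ Q)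
    (hdeg : P.natDegree = Q.natDegree) : polyHeight P ≤ polyHeight Q := by
  obtain ⟨R, rfl⟩ := h
  have hP : P ≠ 0 := left_ne_zero_of_mul hQ
  have hR : R ≠ 0 := right_ne_zero_of_mul hQ
  rw [natDegree_mul hP hR] at hdeg
  obtain ⟨r, rfl⟩ : ∃ r, R = C r := ⟨_, eq_C_of_natDegree_eq_zero (by omega)⟩
  have hr : r ≠ 0 := by simpa using hR
  refine polyHeight_le_iff.2 fun i => le_trans ?_ (natAbs_coeff_le_polyHeight _ i)
  rw [coeff_mul_C, Int.natAbs_mul]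
  exact Nat.le_mul_of_pos_right _ (Int.natAbs_pos.2 hr)

theorem integerNormalization_map_eq_C_mul (p : ℚ[X]) : ∃ b : ℚ, b ≠ 0 ∧
    (IsLocalization.integerNormalization (nonZeroDivisors ℤ) p).map (Int.castRingHom ℚ)
      = C b * p := by
  obtain ⟨b, hb, h⟩ := IsLocalization.integerNormalization_spec (nonZeroDivisors ℤ) p
  refine ⟨(b : ℚ), by exact_mod_cast nonZeroDivisors.ne_zero hb, ?_⟩
  rw [← algebraMap_int_eq, h, ← smul_eq_C_mul]
  ext i
  simp

theorem intMinpoly_isPrimitive (α : ℂ) : (intMinpoly α).IsPrimitive := isPrimitive_primPart _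

theorem associated_map_intMinpoly {α : ℂ} (hα : IsAlgebraic ℚ α) :
    Associated ((intMinpoly α).map (Int.castRingHom ℚ)) (minpoly ℚ α) := by
  set N := IsLocalization.integerNormalization (nonZeroDivisors ℤ) (minpoly ℚ α) with hN
  obtain ⟨b, hb, h⟩ := integerNormalization_map_eq_C_mul (minpoly ℚ α)
  have hm : minpoly ℚ α ≠ 0 := minpoly.ne_zero hα.isIntegral
  have hN0 : N ≠ 0 := fun h0 => by
    rw [← hN, h0] at h
    simp [hb, hm] at h
  have hc : (N.content : ℚ) ≠ 0 := by exact_mod_cast mt content_eq_zero_iff.1 hN0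
  have e : C (N.content : ℚ) * (intMinpoly α).map (Int.castRingHom ℚ) = C b * minpoly ℚ α := by
    rw [← h, ← hN]
    conv_rhs => rw [N.eq_C_content_mul_primPart]
    simp [intMinpoly, hN]
  exact ((associated_isUnit_mul_left_iff (isUnit_C.2 hc.isUnit)).1
    (e ▸ (associated_isUnit_mul_left_iff (isUnit_C.2 hb.isUnit)).2 (Associated.refl _) :))

theorem intMinpoly_dvd {α : ℂ} {Q : ℤ[X]} (hα : IsAlgebraic ℚ α) (h : aeval α Q = 0) :
    intMinpoly α ∣ Q := by
  rw [IsPrimitive.Int.dvd_iff_map_cast_dvd_map_cast _ _ (intMinpoly_isPrimitive α)]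
  refine (associated_map_intMinpoly hα).dvd.trans (minpoly.dvd _ _ ?_)
  rw [← algebraMap_int_eq, aeval_map_algebraMap, h]

theorem natDegree_intMinpoly {α : ℂ} (hα : IsAlgebraic ℚ α) :
    (intMinpoly α).natDegree = (minpoly ℚ α).natDegree := by
  rw [← natDegree_eq_of_degree_eq (degree_eq_degree_of_associated (associated_map_intMinpoly hα)),
    natDegree_map_eq_of_injective (RingHom.injective_int _)]

theorem one_le_algHeight (α : ℂ) : 1 ≤ algHeight α := by
  have h : (intMinpoly α).leadingCoeff ≠ 0 := by
    simpa using (intMinpoly_isPrimitive α).ne_zero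
  exact (Nat.succ_le_of_lt (Int.natAbs_pos.2 h)).trans (natAbs_coeff_le_polyHeight _ _)

theorem isAlgebraic_of_aeval_int_eq_zero {α : ℂ} {Q : ℤ[X]} (hQ : Q ≠ 0) (h : aeval α Q = 0) :
    IsAlgebraic ℚ α :=
  IsAlgebraic.extendScalars (R := ℤ) (RingHom.injective_int _) ⟨Q, hQ, h⟩

theorem algDegLE_of_aeval_eq_zero {α : ℂ} {Q : ℤ[X]} (hQ : Q ≠ 0) (h : aeval α Q = 0) :
    AlgDegLE Q.natDegree α := by
  have hα := isAlgebraic_of_aeval_int_eq_zero hQ h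
  exact ⟨hα, natDegree_intMinpoly hα ▸ natDegree_le_of_dvd (intMinpoly_dvd hα h) hQ⟩

/-- Q need not be primitive, but its primitive part is still Eisenstein, hence irreducible and
associated to `intMinpoly α`. The cofactor in Q is then a nonzero integer, which cannot decrease the
height. -/
theorem algHeight_le_of_isEisensteinAt {α : ℂ} {Q : ℤ[X]} {I : Ideal ℤ} (hI : I.IsPrime)
    (hE : Q.IsEisensteinAt I) (hdeg : 0 < Q.natDegree) (h : aeval α Q = 0) :
    algHeight α ≤ polyHeight Q := by
  have hQ : Q ≠ 0 := fun h0 => by simp [h0] at hdeg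
  have hα := isAlgebraic_of_aeval_int_eq_zero hQ h
  have hirr : Irreducible Q.primPart :=
    (isEisensteinAt_of_C_mul hI (Q.eq_C_content_mul_primPart ▸ hE)).irreducible hI
      Q.isPrimitive_primPart (by rwa [natDegree_primPart])
  have hdvd : intMinpoly α ∣ Q.primPart :=
    ((intMinpoly_isPrimitive α).dvd_primPart_iff_dvd hQ).2 (intMinpoly_dvd hα h)
  have hass : Associated (intMinpoly α) Q.primPart := by
    refine (hirr.dvd_iff.1 hdvd).resolve_left (fun hu => ?_) |>.symm
    have := natDegree_eq_zero_of_isUnit hu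
    rw [natDegree_intMinpoly hα] at this
    exact (minpoly.natDegree_pos hα.isIntegral).ne' this
  refine polyHeight_le_of_dvd_of_natDegree_eq hQ (intMinpoly_dvd hα h) ?_
  rw [← natDegree_primPart Q]
  exact natDegree_eq_of_degree_eq (degree_eq_degree_of_associated hass)

/-- Since f'/f at z is the sum of 1/(z - α) over the roots, some term has at least the average size.
-/
theorem exists_root_norm_sub_mul_le {f : ℂ[X]} {z : ℂ} (hd : f.derivative.eval z ≠ 0) :
    ∃ α, f.IsRoot α ∧ ‖z - α‖ * ‖f.derivative.eval z‖ ≤ f.natDegree * ‖f.eval z‖ := by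
  by_cases hz : f.eval z = 0
  · exact ⟨z, hz, by simp [hz]⟩
  have hf0 : f ≠ 0 := fun h => by simp [h] at hz
  by_contra! H
  have hpos : 0 < ‖f.derivative.eval z‖ := norm_pos_iff.2 hd
  have hroots : ∀ α ∈ f.roots, ‖1 / (z - α)‖ * (f.natDegree * ‖f.eval z‖)
      < ‖f.derivative.eval z‖ := fun α hα => by
    have hr := (mem_roots hf0).1 hα
    have hne : 0 < ‖z - α‖ := norm_pos_iff.2 (sub_ne_zero.2 fun e => hz (e ▸ hr))
    rw [norm_div, norm_one, one_div, inv_mul_lt_iff₀ hne]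
    exact H α hr
  have hcard : (f.roots.card : ℝ) = f.natDegree := by
    exact_mod_cast (IsAlgClosed.splits f).natDegree_eq_card_roots.symm
  have key := (IsAlgClosed.splits f).eval_derivative_div_eval_of_ne_zero hz
  have hne : f.roots ≠ 0 := fun h => by
    rw [h] at key
    simp [hd, hz] at key
  have hdegpos : (0 : ℝ) < f.natDegree := by
    rw [← hcard]; exact_mod_cast Multiset.card_pos.2 hne
  have h1 : ‖f.derivative.eval z / f.eval z‖ ≤ (f.roots.map fun α => ‖1 / (z - α)‖).sum := by
    rw [key]
    simpa [Multiset.map_map, Function.comp_def] using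
      norm_multiset_sum_le (f.roots.map fun α => 1 / (z - α))
  have hM : 0 < (f.natDegree : ℝ) * ‖f.eval z‖ := mul_pos hdegpos (norm_pos_iff.2 hz)
  have h2 : (f.roots.map fun α => ‖1 / (z - α)‖).sum
      < (f.roots.map fun _ => ‖f.derivative.eval z‖ / (f.natDegree * ‖f.eval z‖)).sum :=
    Multiset.sum_lt_sum_of_nonempty hne fun α hα => (lt_div_iff₀ hM).2 (hroots α hα)
  have h3 := h1.trans_lt h2
  rw [Multiset.map_const', Multiset.sum_replicate, nsmul_eq_mul, hcard, norm_div] at h3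
  refine h3.ne ?_
  field_simp

/-! ### Integer points in a residue class -/

theorem exists_congruent_near {ι : Type*} [Fintype ι] {v : ι → ι → ℤ}
    (hv : LinearIndependent ℤ v) {N : ℕ} (hN : 0 < N) (T : ι → ℤ) (Y : ι → ℝ) :
    ∃ (q : ι → ℤ) (c : ι → ℝ), (∀ k, |c k| ≤ N) ∧ (∀ i, (N : ℤ) ∣ q i - T i) ∧
      ∀ i, (q i : ℝ) = Y i - ∑ k, c k * v k i := by
  classical
  set V : Matrix ι ι ℤ := Matrix.of v with hV
  have hdet : V.det ≠ 0 := fun h => by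
    obtain ⟨x, hx, hx0⟩ := Matrix.exists_vecMul_eq_zero_iff.2 h
    refine hx (funext fun i => Fintype.linearIndependent_iff.1 hv x ?_ i)
    ext j
    simpa [Matrix.vecMul, dotProduct, hV] using congrFun hx0 j
  set W : Matrix ι ι ℝ := V.map (Int.castRingHom ℝ) with hW
  have hWdet : IsUnit W.det := by
    rw [hW, ← RingHom.mapMatrix_apply, ← RingHom.map_det]
    exact (by simpa using hdet : ((Int.castRingHom ℝ) V.det) ≠ 0).isUnit
  have hN' : (N : ℝ) ≠ 0 := by positivity
  -- Real coordinates of (Y - T)/N in the basis v. Their integer parts give q, and N times their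
  -- fractional parts give c.
  set s : ι → ℝ := Matrix.vecMul (fun i => (Y i - T i) / N) W⁻¹ with hs
  have hsum : ∀ i, ∑ k, s k * v k i = (Y i - T i) / N := fun i => by
    have : Matrix.vecMul s W = fun i => (Y i - T i) / N := by
      rw [hs, Matrix.vecMul_vecMul, Matrix.nonsing_inv_mul _ hWdet, Matrix.vecMul_one]
    simpa [Matrix.vecMul, dotProduct, hW, hV] using congrFun this i
  refine ⟨fun i => T i + N * ∑ k, ⌊s k⌋ * v k i, fun k => N * Int.fract (s k), fun k => ?_,
    fun i => ⟨∑ k, ⌊s k⌋ * v k i, by ring⟩, fun i => ?_⟩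
  · rw [abs_of_nonneg (mul_nonneg (Nat.cast_nonneg _) (Int.fract_nonneg _))]
    exact mul_le_of_le_one_right (Nat.cast_nonneg _) (Int.fract_lt_one _).le
  · have h1 : ∑ k, (N * Int.fract (s k)) * v k i
        = N * (∑ k, s k * v k i) - N * ∑ k, (⌊s k⌋ : ℝ) * v k i := by
      rw [Finset.mul_sum, Finset.mul_sum, ← Finset.sum_sub_distrib]
      exact Finset.sum_congr rfl fun k _ => by rw [Int.fract]; ring
    rw [h1, hsum, mul_div_cancel₀ _ hN']
    push_cast
    ring

theorem abs_sum_mul_le {ι : Type*} (s : Finset ι) {a b : ι → ℝ} {B : ℝ}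
    (hb : ∀ i ∈ s, |b i| ≤ B) : |∑ i ∈ s, a i * b i| ≤ (∑ i ∈ s, |a i|) * B := by
  rw [Finset.sum_mul]
  refine (Finset.abs_sum_le_sum_abs _ _).trans (Finset.sum_le_sum fun i hi => ?_)
  rw [abs_mul]
  exact mul_le_mul_of_nonneg_left (hb i hi) (abs_nonneg _)

/-- The system does not bound the constant coefficient directly; it is recovered from the linear
form, as X^(-ν) ≤ X. -/
theorem IsLinFormSol.abs_le {n : ℕ} {ζ ν X : ℝ} (hν : -1 ≤ ν) (hX : 1 ≤ X)
    {v : Fin (n + 1) → ℤ} (h : IsLinFormSol n ζ ν X v) (i : Fin (n + 1)) :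
    |(v i : ℝ)| ≤ (1 + ∑ i : Fin (n + 1), |ζ ^ (i : ℕ)|) * X := by
  have hS : 0 ≤ ∑ i : Fin n, |ζ ^ (i.succ : ℕ)| := Finset.sum_nonneg fun i _ => abs_nonneg _
  rw [Fin.sum_univ_succ (fun i : Fin (n + 1) => |ζ ^ (i : ℕ)|)]
  refine Fin.cases ?_ (fun j => (h.1 j).trans ?_) i
  · have h2 := h.2
    rw [Fin.sum_univ_succ] at h2
    have h3 := abs_sum_mul_le Finset.univ (a := fun i : Fin n => ζ ^ (i.succ : ℕ))
      (b := fun i => (v i.succ : ℝ)) fun i _ => h.1 i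
    have h4 : X ^ (-ν) ≤ X := by
      simpa using Real.rpow_le_rpow_of_exponent_le hX (by linarith : -ν ≤ 1)
    simp only [Fin.val_zero, pow_zero, one_mul, abs_one] at h2 h3 ⊢
    have h5 := abs_sub (((v 0 : ℝ)) + ∑ i : Fin n, ζ ^ (i.succ : ℕ) * (v i.succ : ℝ))
      (∑ i : Fin n, ζ ^ (i.succ : ℕ) * (v i.succ : ℝ))
    rw [add_sub_cancel_right] at h5
    nlinarith
  · simp only [Fin.val_zero, pow_zero, abs_one]
    nlinarith

/-- The integer polynomial with coefficient vector `q`. -/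
noncomputable def polyOfVec {n : ℕ} (q : Fin (n + 1) → ℤ) : ℤ[X] :=
  ∑ i : Fin (n + 1), monomial (i : ℕ) (q i)

theorem coeff_polyOfVec {n : ℕ} (q : Fin (n + 1) → ℤ) (i : Fin (n + 1)) :
    (polyOfVec q).coeff i = q i := by
  simp [polyOfVec, coeff_monomial, Fin.val_inj]

theorem coeff_polyOfVec_of_lt {n : ℕ} (q : Fin (n + 1) → ℤ) {j : ℕ} (hj : n < j) :
    (polyOfVec q).coeff j = 0 := by
  simp only [polyOfVec, finsetSum_coeff, coeff_monomial]
  exact Finset.sum_eq_zero fun i _ => if_neg (by omega)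

theorem natDegree_polyOfVec {n : ℕ} (q : Fin (n + 1) → ℤ) (h : q (Fin.last n) ≠ 0) :
    (polyOfVec q).natDegree = n := by
  refine natDegree_eq_of_le_of_coeff_ne_zero
    (natDegree_le_iff_coeff_eq_zero.2 fun j hj => coeff_polyOfVec_of_lt q hj) ?_
  simpa using (coeff_polyOfVec q (Fin.last n)).trans_ne h

theorem polyHeight_polyOfVec_le {n : ℕ} (q : Fin (n + 1) → ℤ) {B : ℝ}
    (h : ∀ i, |(q i : ℝ)| ≤ B) : (polyHeight (polyOfVec q) : ℝ) ≤ B := by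
  have hB : 0 ≤ B := (abs_nonneg _).trans (h 0)
  refine (Nat.le_floor_iff hB).1 (polyHeight_le_iff.2 fun i => ?_)
  rcases lt_or_ge n i with hi | hi
  · simp [coeff_polyOfVec_of_lt q hi]
  · have := coeff_polyOfVec q ⟨i, Nat.lt_succ_of_le hi⟩
    simp only at this
    rw [this, Nat.le_floor_iff hB, Nat.cast_natAbs, Int.cast_abs]
    exact h _

theorem eval_map_polyOfVec {n : ℕ} (q : Fin (n + 1) → ℤ) (z : ℝ) :
    ((polyOfVec q).map (Int.castRingHom ℂ)).eval (z : ℂ)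
      = ((∑ i : Fin (n + 1), z ^ (i : ℕ) * (q i : ℝ) : ℝ) : ℂ) := by
  simp [polyOfVec, Polynomial.map_sum, eval_finsetSum, mul_comm]

theorem eval_derivative_map_polyOfVec {n : ℕ} (q : Fin (n + 1) → ℤ) (z : ℝ) :
    ((polyOfVec q).map (Int.castRingHom ℂ)).derivative.eval (z : ℂ)
      = ((∑ i : Fin (n + 1), (i : ℕ) * z ^ ((i : ℕ) - 1) * (q i : ℝ) : ℝ) : ℂ) := by
  simp only [polyOfVec, Polynomial.map_sum, derivative_sum, map_monomial, derivative_monomial,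
    eval_finsetSum, eval_monomial]
  push_cast
  exact Finset.sum_congr rfl fun i _ => by simp; ring

theorem isEisensteinAt_polyOfVec {n : ℕ} (q : Fin (n + 1) → ℤ)
    (hlast : ¬ (2 : ℤ) ∣ q (Fin.last n)) (h0 : ¬ (4 : ℤ) ∣ q 0)
    (h : ∀ i, i ≠ Fin.last n → (2 : ℤ) ∣ q i) :
    (polyOfVec q).IsEisensteinAt (Ideal.span {2}) := by
  have hdeg := natDegree_polyOfVec q fun h => hlast (h ▸ dvd_zero _)
  refine ⟨?_, fun {m} hm => ?_, ?_⟩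
  · have := coeff_polyOfVec q (Fin.last n)
    rw [Fin.val_last] at this
    rwa [leadingCoeff, hdeg, this, Ideal.mem_span_singleton]
  · rw [hdeg] at hm
    have := coeff_polyOfVec q ⟨m, by omega⟩
    simp only at this
    rw [this, Ideal.mem_span_singleton]
    exact h _ fun e => by simp [Fin.ext_iff] at e; omega
  · have := coeff_polyOfVec q 0
    rw [Fin.val_zero] at this
    rw [this, Ideal.span_singleton_pow, Ideal.mem_span_singleton]
    norm_num
    exact h0

theorem sum_mul_eq_sub {ι : Type*} [Fintype ι] {v : ι → ι → ℤ} {q : ι → ℤ} {c Y : ι → ℝ}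
    (h : ∀ i, (q i : ℝ) = Y i - ∑ k, c k * v k i) (a : ι → ℝ) :
    ∑ i, a i * (q i : ℝ) = ∑ i, a i * Y i - ∑ k, (∑ i, a i * v k i) * c k := by
  simp only [h, mul_sub, Finset.sum_sub_distrib, Finset.mul_sum, Finset.sum_mul]
  rw [Finset.sum_comm]
  congr 1
  exact Finset.sum_congr rfl fun k _ => Finset.sum_congr rfl fun i _ => by ring

/-! ### Construction of the algebraic approximation -/

theorem exists_algebraic_of_hasIndepSols {n : ℕ} (hn : 1 ≤ n) (ζ : ℝ) :
    ∃ K : ℝ, 1 ≤ K ∧ ∀ ν X : ℝ, -1 ≤ ν → 1 ≤ X → HasIndepSols n (n + 1) ζ ν X →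
      ∃ α : ℂ, AlgDegLE n α ∧ (algHeight α : ℝ) ≤ K * X ∧
        ‖(ζ : ℂ) - α‖ ≤ K * X ^ (-ν - 1) := by
  set M : ℝ := 1 + ∑ i : Fin (n + 1), |ζ ^ (i : ℕ)| with hM
  set D : ℝ := ∑ i : Fin (n + 1), |(i : ℕ) * ζ ^ ((i : ℕ) - 1)| with hD
  have hM1 : 1 ≤ M := le_add_of_nonneg_right (Finset.sum_nonneg fun i _ => abs_nonneg _)
  have hD0 : 0 ≤ D := Finset.sum_nonneg fun i _ => abs_nonneg _
  -- The perturbation changes the derivative at ζ by at most (n + 1) * 4 * D * M * X; the extra 1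
  -- leaves a slope of at least X.
  set A : ℝ := (n + 1) * (D * M) * 4 + 1 with hA
  have hA1 : 1 ≤ A := by
    have : 0 ≤ (n + 1) * (D * M) * 4 := by positivity
    linarith
  refine ⟨A * (1 + |ζ|) + (n + 1) * M * 4 + n * ((n + 1) * 4), ?_, ?_⟩
  · have h1 : 0 ≤ A * |ζ| := by positivity
    have h2 : 0 ≤ (n + 1) * M * 4 + n * (((n : ℝ) + 1) * 4) := by positivity
    linarith
  rintro ν X hν hX ⟨v, hv, hsol⟩
  have hX0 : 0 < X := by linarith
  have hvb : ∀ k i, |(v k i : ℝ)| ≤ M * X := fun k i => (hsol k).abs_le hν hX i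
  set e₁ : Fin (n + 1) := ⟨1, by omega⟩ with he₁
  have he : (0 : Fin (n + 1)) ≠ e₁ := by simp [he₁, Fin.ext_iff]
  set Y : Fin (n + 1) → ℝ := Pi.single 0 (-(A * X * ζ)) + Pi.single e₁ (A * X) with hY
  have hsumY : ∀ a : Fin (n + 1) → ℝ, ∑ i, a i * Y i = A * X * (a e₁ - ζ * a 0) := fun a => by
    simp only [hY, Pi.add_apply, mul_add, Finset.sum_add_distrib, Pi.single_apply, mul_ite,
      mul_zero, Finset.sum_ite_eq', Finset.mem_univ, if_true]
    ring
  have hLY : ∑ i : Fin (n + 1), ζ ^ (i : ℕ) * Y i = 0 := by simp [hsumY, he₁]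
  have hDY : ∑ i : Fin (n + 1), ((i : ℕ) * ζ ^ ((i : ℕ) - 1)) * Y i = A * X := by
    simp [hsumY, he₁]
  have hYb : ∀ i, |Y i| ≤ A * (1 + |ζ|) * X := fun i => by
    have h1 : 0 ≤ A * X * |ζ| := by positivity
    have h2 : 0 ≤ A * X := by positivity
    by_cases h0 : i = 0
    · subst h0
      simp only [hY, Pi.add_apply, Pi.single_eq_same, Pi.single_eq_of_ne he, add_zero, abs_neg,
        abs_mul, abs_of_pos hX0, abs_of_pos (by linarith : 0 < A)]
      linarith
    · by_cases h1 : i = e₁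
      · subst h1
        simp only [hY, Pi.add_apply, Pi.single_eq_same, Pi.single_eq_of_ne h0, zero_add,
          abs_of_nonneg h2]
        linarith
      · simp only [hY, Pi.add_apply, Pi.single_eq_of_ne h0, Pi.single_eq_of_ne h1, add_zero,
          abs_zero]
        positivity
  -- Target T^n + 2 modulo 4: modulus 4 is needed to keep 4 from dividing the constant term.
  obtain ⟨q, c, hc, hqT, hq⟩ := exists_congruent_near hv (N := 4) (by norm_num)
    (fun i => if i = Fin.last n then 1 else if i = 0 then 2 else 0) Y
  have hc4 : ∑ k, |c k| ≤ (n + 1) * 4 := by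
    refine (Finset.sum_le_sum fun k _ => hc k).trans ?_
    simp
  have hl : (0 : Fin (n + 1)) ≠ Fin.last n := by simp [Fin.ext_iff]; omega
  have hqlast : ¬ (2 : ℤ) ∣ q (Fin.last n) := by
    have := hqT (Fin.last n)
    rw [if_pos rfl] at this
    push_cast at this
    omega
  have hq0 : (4 : ℤ) ∣ q 0 - 2 := by simpa [hl] using hqT 0
  have hqeven : ∀ i, i ≠ Fin.last n → (2 : ℤ) ∣ q i := fun i hi => by
    have := hqT i
    rw [if_neg hi] at this
    push_cast at this
    split_ifs at this <;> omega
  have hqb : ∀ i, |(q i : ℝ)| ≤ (A * (1 + |ζ|) + (n + 1) * M * 4) * X := fun i => by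
    have h1 := abs_sum_mul_le Finset.univ (a := c) (b := fun k => (v k i : ℝ))
      fun k _ => hvb k i
    have h2 := abs_sub (Y i) (∑ k, c k * v k i)
    have h3 := mul_le_mul_of_nonneg_right hc4 (by positivity : 0 ≤ M * X)
    rw [hq]
    linarith [hYb i]
  set Q := polyOfVec q with hQ
  have hQdeg : Q.natDegree = n := natDegree_polyOfVec q fun h => hqlast (h ▸ dvd_zero _)
  have hQ0 : Q ≠ 0 := fun h => by simp [h] at hQdeg; omega
  have hQE : Q.IsEisensteinAt (Ideal.span {2}) :=
    isEisensteinAt_polyOfVec q hqlast (by omega) hqeven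
  have hval : ‖(Q.map (Int.castRingHom ℂ)).eval (ζ : ℂ)‖ ≤ (n + 1) * 4 * X ^ (-ν) := by
    rw [eval_map_polyOfVec, Complex.norm_real, Real.norm_eq_abs, sum_mul_eq_sub hq, hLY, zero_sub,
      abs_neg]
    simp_rw [mul_comm _ (c _)]
    exact (abs_sum_mul_le _ fun k _ => (hsol k).2).trans
      (mul_le_mul_of_nonneg_right hc4 (by positivity))
  have hder : X ≤ ‖(Q.map (Int.castRingHom ℂ)).derivative.eval (ζ : ℂ)‖ := by
    rw [eval_derivative_map_polyOfVec, Complex.norm_real, Real.norm_eq_abs, sum_mul_eq_sub hq, hDY]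
    simp_rw [mul_comm _ (c _)]
    have h1 := abs_sum_mul_le Finset.univ (a := c)
      (b := fun k => ∑ i : Fin (n + 1), ((i : ℕ) * ζ ^ ((i : ℕ) - 1)) * (v k i : ℝ))
      fun k _ => abs_sum_mul_le Finset.univ fun i _ => hvb k i
    have h2 := mul_le_mul_of_nonneg_right hc4 (by positivity : 0 ≤ D * (M * X))
    refine le_trans ?_ (le_abs_self _)
    have h3 := le_abs_self (∑ k, c k *
      ∑ i : Fin (n + 1), ((i : ℕ) * ζ ^ ((i : ℕ) - 1)) * (v k i : ℝ))
    rw [hA]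
    linarith
  obtain ⟨α, hroot, hle⟩ := exists_root_norm_sub_mul_le (norm_pos_iff.1 (hX0.trans_le hder))
  have haev : aeval α Q = 0 := by
    rwa [IsRoot, eval_map, ← algebraMap_int_eq, ← aeval_def] at hroot
  refine ⟨α, hQdeg ▸ algDegLE_of_aeval_eq_zero hQ0 haev, ?_, ?_⟩
  · have h1 : (algHeight α : ℝ) ≤ polyHeight Q := by
      exact_mod_cast algHeight_le_of_isEisensteinAt
        ((Ideal.span_singleton_prime two_ne_zero).2 Int.prime_two) hQE (by omega) haev
    have h2 := polyHeight_polyOfVec_le q hqb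
    have h3 : 0 ≤ n * (((n : ℝ) + 1) * 4) * X := by positivity
    linarith
  · rw [natDegree_map_eq_of_injective (RingHom.injective_int _), hQdeg] at hle
    have h1 : ‖(ζ : ℂ) - α‖ * X ≤ n * ((n + 1) * 4) * X ^ (-ν) :=
      (mul_le_mul_of_nonneg_left hder (norm_nonneg _)).trans <| hle.trans <|
        (mul_le_mul_of_nonneg_left hval (Nat.cast_nonneg _)).trans_eq (by ring)
    rw [Real.rpow_sub_one hX0.ne', ← mul_div_assoc, le_div_iff₀ hX0]
    refine h1.trans (mul_le_mul_of_nonneg_right ?_ (by positivity))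
    have h2 : 0 ≤ A * (1 + |ζ|) + (n + 1) * M * 4 := by positivity
    linarith

/-! ### Passage to the exponents -/

/-- The standard basis suffices. This lets a negative exponent be raised to meet the condition -1 ≤
ν of the construction. -/
theorem eventually_hasIndepSols_of_neg (n : ℕ) (ζ : ℝ) {ν : ℝ} (hν : ν < 0) :
    ∀ᶠ X : ℝ in atTop, HasIndepSols n (n + 1) ζ ν X := by
  have h : ∀ᶠ X : ℝ in atTop, ∀ k : Fin (n + 1), |ζ ^ (k : ℕ)| ≤ X ^ (-ν) :=
    eventually_all.2 fun k => (tendsto_rpow_atTop (neg_pos.2 hν)).eventually_ge_atTop _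
  filter_upwards [h, eventually_ge_atTop 1] with X hX hX1
  refine ⟨fun k => Pi.single k 1, Pi.linearIndependent_single_one _ _, fun k => ⟨fun i => ?_, ?_⟩⟩
  · by_cases e : i.succ = k
    · simpa [e] using hX1
    · simpa [Pi.single_eq_of_ne e] using zero_le_one.trans hX1
  · simpa [Pi.single_apply] using hX k

theorem eventually_const_mul_rpow_le (K : ℝ) {a b : ℝ} (h : a < b) :
    ∀ᶠ X : ℝ in atTop, K * X ^ a ≤ X ^ b := by
  filter_upwards [(tendsto_rpow_atTop (sub_pos.2 h)).eventually_ge_atTop K,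
    eventually_gt_atTop 0] with X hX hX0
  calc K * X ^ a ≤ X ^ (b - a) * X ^ a := by gcongr
    _ = X ^ b := by rw [← Real.rpow_add hX0, sub_add_cancel]

theorem sSup_coe_image_le {S T : Set ℝ}
    (h : ∀ ν ∈ S, ∀ μ < ν, ∃ ρ ∈ T, μ ≤ ρ) :
    sSup ((fun ν : ℝ => (ν : EReal)) '' S) ≤ sSup ((fun ν : ℝ => (ν : EReal)) '' T) := by
  refine sSup_le ?_
  rintro _ ⟨ν, hν, rfl⟩
  refine EReal.ge_of_forall_gt_iff_ge.1 fun z hz => ?_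
  obtain ⟨ρ, hρ, hle⟩ := h ν hν z (EReal.coe_lt_coe_iff.1 hz)
  exact (EReal.coe_le_coe_iff.2 hle).trans (le_sSup ⟨ρ, hρ, rfl⟩)

theorem w_le_wStar {n : ℕ} (hn : 1 ≤ n) {ζ : ℝ} (hζ : ¬ AlgDegLE n (ζ : ℂ)) :
    w n (n + 1) ζ ≤ wStar n ζ := by
  refine sSup_coe_image_le fun ν₀ (hν₀ : ∃ᶠ X in atTop, _) μ₀ hμ₀ => ?_
  obtain ⟨K, hK, hα⟩ := exists_algebraic_of_hasIndepSols hn ζ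
  obtain ⟨ν, μ, hμν, hμ1, hμ, hν⟩ : ∃ ν μ : ℝ, μ < ν ∧ -1 < μ ∧ μ₀ ≤ μ ∧
      ∃ᶠ X in atTop, HasIndepSols n (n + 1) ζ ν X := by
    rcases le_or_gt 0 ν₀ with h | h
    · exact ⟨ν₀, max μ₀ (-1 / 2), max_lt hμ₀ (by linarith),
        lt_max_of_lt_right (by norm_num), le_max_left _ _, hν₀⟩
    · refine ⟨max ν₀ (-1 / 3), max μ₀ (-1 / 2), max_lt_max hμ₀ (by norm_num),
        lt_max_of_lt_right (by norm_num), le_max_left _ _, ?_⟩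
      exact (eventually_hasIndepSols_of_neg n ζ (max_lt h (by norm_num))).frequently
  refine ⟨μ, fun hfin => ?_, hμ⟩
  -- If only finitely many α qualified, they would keep a positive distance from ζ, which is not
  -- among them; the construction at large X contradicts this.
  have hfar : ∃ δ > 0, ∀ α : ℂ,
      AlgDegLE n α ∧ ‖(ζ : ℂ) - α‖ ≤ (algHeight α : ℝ) ^ (-μ - 1) → δ ≤ ‖(ζ : ℂ) - α‖ := by
    obtain ⟨δ, hδ, hball⟩ := Metric.isOpen_iff.1 hfin.isClosed.isOpen_compl (ζ : ℂ)
      fun h => hζ h.1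
    refine ⟨δ, hδ, fun α h => ?_⟩
    by_contra! hlt
    exact hball (by rwa [Metric.mem_ball, dist_comm, dist_eq_norm]) h
  obtain ⟨δ, hδ, hfar⟩ := hfar
  have hsmall : ∀ᶠ X : ℝ in atTop, K * X ^ (-ν - 1) < δ := by
    have := (tendsto_rpow_neg_atTop (by linarith : 0 < ν + 1)).const_mul K
    rw [mul_zero] at this
    refine (this.eventually_lt_const hδ).mono fun X hX => ?_
    rwa [show -ν - 1 = -(ν + 1) by ring]
  have hcmp := eventually_const_mul_rpow_le (K * (K ^ (-μ - 1))⁻¹)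
    (by linarith : -ν - 1 < -μ - 1)
  obtain ⟨X, hX, hX1, hXδ, hXc⟩ :=
    (hν.and_eventually ((eventually_ge_atTop 1).and (hsmall.and hcmp))).exists
  obtain ⟨α, hdeg, hH, hdist⟩ := hα ν X (by linarith) hX1 hX
  have hH1 : (1 : ℝ) ≤ algHeight α := by exact_mod_cast one_le_algHeight α
  refine (hfar α ⟨hdeg, hdist.trans ?_⟩).not_gt (hdist.trans_lt hXδ)
  -- Since μ > -1 the exponent -μ - 1 is negative, so H(α) ≤ K X bounds H(α)^(-μ-1) from below; the
  -- gap μ < ν absorbs K.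
  have hKpos : 0 < K ^ (-μ - 1) := Real.rpow_pos_of_pos (by linarith) _
  calc K * X ^ (-ν - 1) = K ^ (-μ - 1) * (K * (K ^ (-μ - 1))⁻¹ * X ^ (-ν - 1)) := by
        field_simp
    _ ≤ K ^ (-μ - 1) * X ^ (-μ - 1) := by gcongr
    _ = (K * X) ^ (-μ - 1) := (Real.mul_rpow (by linarith) (by linarith)).symm
    _ ≤ (algHeight α : ℝ) ^ (-μ - 1) :=
        Real.rpow_le_rpow_of_nonpos (by linarith) hH (by linarith)

theorem wHat_le_wStarHatStrict {n : ℕ} (hn : 1 ≤ n) (ζ : ℝ) :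
    wHat n (n + 1) ζ ≤ wStarHatStrict n ζ := by
  refine sSup_coe_image_le fun ν₀ (hν₀ : ∀ᶠ X in atTop, _) μ hμ => ?_
  obtain ⟨K, hK, hα⟩ := exists_algebraic_of_hasIndepSols hn ζ
  have hK0 : 0 < K := by linarith
  obtain ⟨ν, hν1, hμν, hν⟩ : ∃ ν : ℝ, -1 ≤ ν ∧ μ < ν ∧
      ∀ᶠ X in atTop, HasIndepSols n (n + 1) ζ ν X := by
    rcases le_or_gt 0 ν₀ with h | h
    · exact ⟨ν₀, by linarith, hμ, hν₀⟩
    · exact ⟨max ν₀ (-1), le_max_right _ _, lt_max_of_lt_left hμ,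
        eventually_hasIndepSols_of_neg n ζ (max_lt h (by norm_num))⟩
  refine ⟨μ, ?_, le_rfl⟩
  -- Applying the construction at X / K makes the height at most X exactly.
  have hdiv : Tendsto (fun X : ℝ => X / K) atTop atTop := tendsto_id.atTop_div_const hK0
  filter_upwards [hdiv.eventually hν, hdiv.eventually (eventually_ge_atTop 1),
    eventually_const_mul_rpow_le (K * (K ^ (-ν - 1))⁻¹) (by linarith : -ν - 1 < -μ - 1),
    eventually_ge_atTop 0] with X hX hX1 hXc hX0
  obtain ⟨α, hdeg, hH, hdist⟩ := hα ν (X / K) hν1 hX1 hX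
  rw [mul_div_cancel₀ _ hK0.ne'] at hH
  refine ⟨α, hdeg, hH, hdist.trans (le_trans (le_of_eq ?_) hXc)⟩
  rw [Real.div_rpow hX0 hK0.le]
  ring

theorem wStarHatStrict_le_wStarHat (n : ℕ) (ζ : ℝ) : wStarHatStrict n ζ ≤ wStarHat n ζ := by
  refine sSup_le_sSup (Set.image_mono fun ν (hν : ∀ᶠ X in atTop, _) => ?_)
  filter_upwards [hν, eventually_gt_atTop 0] with X ⟨α, hdeg, hH, hdist⟩ hX0
  refine ⟨α, hdeg, hH, hdist.trans ?_⟩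
  have hH1 : (0 : ℝ) < algHeight α := by exact_mod_cast one_le_algHeight α
  rw [Real.rpow_sub_one hX0.ne', div_eq_inv_mul]
  gcongr
end DiophApprox

theorem theorem1 (n : ℕ) (hn : 1 ≤ n) (ζ : ℝ) (hζ : ¬ DiophApprox.AlgDegLE n (ζ : ℂ)) :
    DiophApprox.wStar n ζ ≥ DiophApprox.w n (n + 1) ζ ∧
      DiophApprox.wStarHat n ζ ≥ DiophApprox.wHat n (n + 1) ζ ∧
      DiophApprox.wStarHatStrict n ζ ≥ DiophApprox.wHat n (n + 1) ζ :=
  have h := DiophApprox.wHat_le_wStarHatStrict hn ζ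
  ⟨DiophApprox.w_le_wStar hn hζ, h.trans (DiophApprox.wStarHatStrict_le_wStarHat n ζ), h⟩
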